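/- Let $E/\mathbb{Q}$ be an elliptic curve. For a prime $p$ let $a_p=a_p(E)$ be its trace of Frobenius, i.e. the coefficient in the local factor $1-a_pT+\cdots$ of $L(E,s)$ at $p$: $a_p=p+1-\#E(\mathbb{F}_p)$ if $E$ has good reduction at $p$, and $a_p=1,-1,0$ if the reduction is split multiplicative, nonsplit multiplicative, additive, respectively. The canonical RSCO basepoint $(u_p,\lambda_p)\in\mathbb{R}^2$ of $E$ at $p$ is given by $$w_p=\frac{a_p+\sqrt{4p(p+1)-a_p^2}}{2p},\qquad u_p=\sqrt{w_p},\qquad \lambda_p=w_p^{3/2}-\frac{a_p}{2p}\,w_p^{1/2}$$ (the radicand and $w_p$ are positive). Put $$\bar u(X)=\frac{\sum_{p\le X}\log p\cdot u_p}{\sum_{p\le X}\log p},\qquad \bar\lambda(X)=\frac{\sum_{p\le X}\log p\cdot \lambda_p}{\sum_{p\le X}\log p},$$ the sums being over all primes $p\le X$. Theorem (Universal basepoint accumulation). For every elliptic curve $E/\mathbb{Q}$, $\bar u(X)\to1$ and $\bar\lambda(X)\to1$ as $X\to\infty$. There is an absolute constant $C$ such that for every elliptic curve $E/\mathbb{Q}$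 $$|\bar u(X)-1|+|\bar\lambda(X)-1|\le\frac{C}{\log\log X}\quad(X\ge3),\qquad\text{and in fact}\qquad |\bar u(X)-1|+|\bar\lambda(X)-1|\le\frac{C}{\sqrt X}\quad(X\ge2).$$ The same holds if all four sums are restricted to the primes $p\le X$ at which $E$ has good reduction, again with an absolute constant $C$ in both bounds, which then hold for all $X\ge X_0(E)$. -/

import Mathlib

open scoped Topology

namespace RSCO

noncomputable section

/-- The Frobenius trace `a_p` of an elliptic curve `E` over `ℚ`, read off from the local `L`-factor
`1 - a_p T + …` of a minimal Weierstrass equation over `ℤ_p`: at a prime of good reduction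
`a_p = p + 1 - #E(𝔽_p)`, and at a prime of split multiplicative, nonsplit multiplicative or additive
reduction it is `1`, `-1` or `0`. (The value at a non-prime is irrelevant.) -/
def frobeniusTrace (E : WeierstrassCurve ℚ) (p : ℕ) : ℤ :=
  if hp : p.Prime then
    haveI : Fact p.Prime := ⟨hp⟩;
    -((E.baseChange ℚ_[p]).localPolynomial ℤ_[p]).coeff 1
  else 0

/-- `E` has good reduction at the prime `p`: a minimal Weierstrass equation of `E` over `ℤ_p` has
unit discriminant. -/
def GoodAt (E : WeierstrassCurve ℚ) (p : ℕ) : Prop :=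
  ∃ hp : p.Prime,
    haveI : Fact p.Prime := ⟨hp⟩;
    ((E.baseChange ℚ_[p]).minimal ℤ_[p]).HasGoodReduction ℤ_[p]

/-- `w_p = (a_p + √(4p(p+1) - a_p²)) / (2p)`. Both the radicand and `w_p` are positive, because
`a_p² ≤ 4p`. -/
def basepointW (E : WeierstrassCurve ℚ) (p : ℕ) : ℝ :=
  ((frobeniusTrace E p : ℝ) + √(4 * (p : ℝ) * ((p : ℝ) + 1) - (frobeniusTrace E p : ℝ) ^ 2)) /
    (2 * (p : ℝ))

/-- The coordinate `u_p = √w_p` (positive root) of the canonical basepoint. -/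
def basepointU (E : WeierstrassCurve ℚ) (p : ℕ) : ℝ :=
  √(basepointW E p)

/-- The coordinate `λ_p = w_p^{3/2} - (a_p / (2p)) w_p^{1/2}` of the canonical basepoint. -/
def basepointLambda (E : WeierstrassCurve ℚ) (p : ℕ) : ℝ :=
  basepointW E p ^ (3 / 2 : ℝ) -
    (frobeniusTrace E p : ℝ) / (2 * (p : ℝ)) * basepointW E p ^ (1 / 2 : ℝ)

/-- The primes `p ≤ X`. -/
def primesUpTo (X : ℝ) : Finset ℕ :=
  (Finset.Icc 1 ⌊X⌋₊).filter Nat.Prime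

open Classical in
/-- The primes `p ≤ X` of good reduction for `E`. -/
def goodPrimesUpTo (E : WeierstrassCurve ℚ) (X : ℝ) : Finset ℕ :=
  (primesUpTo X).filter (GoodAt E)

/-- The mean of `f` over `S` with weights `log p`. -/
def logMean (S : Finset ℕ) (f : ℕ → ℝ) : ℝ :=
  (∑ p ∈ S, Real.log (p : ℝ) * f p) / ∑ p ∈ S, Real.log (p : ℝ)

/-- `ū(X)`: the mean of `u_p` over all primes `p ≤ X`. -/
def uMean (E : WeierstrassCurve ℚ) (X : ℝ) : ℝ :=
  logMean (primesUpTo X) (basepointU E)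

/-- `λ̄(X)`: the mean of `λ_p` over all primes `p ≤ X`. -/
def lambdaMean (E : WeierstrassCurve ℚ) (X : ℝ) : ℝ :=
  logMean (primesUpTo X) (basepointLambda E)

/-- The mean of `u_p` over the primes `p ≤ X` of good reduction. -/
def uMeanGood (E : WeierstrassCurve ℚ) (X : ℝ) : ℝ :=
  logMean (goodPrimesUpTo E X) (basepointU E)

/-- The mean of `λ_p` over the primes `p ≤ X` of good reduction. -/
def lambdaMeanGood (E : WeierstrassCurve ℚ) (X : ℝ) : ℝ :=
  logMean (goodPrimesUpTo E X) (basepointLambda E)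

end

end RSCO

/-! Put t = a_p/(2p). Then w_p = t + √(1 + 1/p - t²) and λ_p = u_p √(1 + 1/p - t²), so any bound
|a_p| ≤ A√p with an absolute A gives u_p = 1 + O(1/√p) and λ_p = 1 + O(1/√p) uniformly in E. The
weighted means then differ from 1 by O(∑ log p/√p) / θ(X), and Chebyshev's bounds make this O(√X /
X). The log log bound is weaker than the 1/√X bound.

The arithmetic input is a Hasse bound with constant 64 in place of 2 (`abs_frobeniusTrace_le`),
proved by Stepanov's method. Completing the square turns the point count into ∑ χ(F(x)) with F cubic
and χ the quadratic character. To count the x with F(x)^h = ε, where p = 2h + 1, linear algebra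
yields a nonzero polynomial of controlled degree vanishing to high order at each such x
(`card_mul_le`). Applying this to ε = 1 and ε = -1 bounds the character sum from both sides.

For good primes only, the finitely many bad primes have bounded total weight, so they cost at most
half of the lower bound for θ(X) once X is large in terms of E; only the threshold depends on E. -/

namespace Stepanov

open Polynomial

/-! ### Stepanov's auxiliary polynomial for a cubic. -/

variable {K : Type*} [Field K]

/-- The operators `T_k` with `D^k (F ^ e * P) = F ^ (e - k) * T_k P`. -/
noncomputable def derivOp (F : K[X]) (e : ℕ) : ℕ → K[X] →ₗ[K] K[X]
  | 0 => LinearMap.id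
  | k + 1 => ((e : K) - k) • (LinearMap.mulLeft K (derivative F) ∘ₗ derivOp F e k) +
      LinearMap.mulLeft K F ∘ₗ derivative ∘ₗ derivOp F e k

lemma derivOp_succ (F : K[X]) (e k : ℕ) (P : K[X]) :
    derivOp F e (k + 1) P = C ((e : K) - k) * (derivative F * derivOp F e k P) +
      F * derivative (derivOp F e k P) := by
  simp [derivOp, smul_eq_C_mul]

lemma iterate_derivative_pow_mul (F : K[X]) (e : ℕ) (P : K[X]) {k : ℕ} (hk : k ≤ e) :
    derivative^[k] (F ^ e * P) = F ^ (e - k) * derivOp F e k P := by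
  induction k with
  | zero => simp [derivOp]
  | succ k ih =>
    rw [Function.iterate_succ_apply', ih (by omega), derivOp_succ]
    obtain ⟨n, rfl⟩ : ∃ n, e = k + 1 + n := ⟨e - (k + 1), by omega⟩
    have h1 : k + 1 + n - k = n + 1 := by omega
    have h2 : k + 1 + n - (k + 1) = n := by omega
    rw [h1, h2, derivative_mul, derivative_pow]
    simp only [Nat.add_sub_cancel]
    push_cast
    simp only [C_add, C_sub, map_natCast, C_1]
    ring

lemma natDegree_derivOp_le {F : K[X]} (hF : F.natDegree ≤ 3) (e : ℕ) {P : K[X]} {n : ℕ}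
    (hP : P.natDegree ≤ n) (k : ℕ) : (derivOp F e k P).natDegree ≤ n + 2 * k := by
  induction k with
  | zero => simpa [derivOp] using hP
  | succ k ih =>
    rw [derivOp_succ]
    have hF' : (derivative F).natDegree ≤ 2 := (natDegree_derivative_le F).trans (by omega)
    refine natDegree_add_le_of_degree_le ((natDegree_C_mul_le _ _).trans
      (natDegree_mul_le.trans (by omega))) ?_
    rcases Nat.eq_zero_or_pos (derivOp F e k P).natDegree with h0 | h0
    · rw [derivative_of_natDegree_zero h0]; simp
    · have := natDegree_derivative_le (derivOp F e k P)
      exact natDegree_mul_le.trans (by omega)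

/-- In characteristic p the factor X^(pj) has derivative zero. It therefore survives untouched until
evaluation, where x^p = x collapses it to x^j; this is why the conditions have much smaller degree
than the auxiliary polynomial. -/
lemma derivOp_X_pow_mul {p : ℕ} [CharP K p] (F : K[X]) (e k j : ℕ) (P : K[X]) :
    derivOp F e k (X ^ (p * j) * P) = X ^ (p * j) * derivOp F e k P := by
  induction k with
  | zero => simp [derivOp]
  | succ k ih =>
    have h0 : derivative (X ^ (p * j) : K[X]) = 0 := by
      rw [derivative_X_pow]; simp
    rw [derivOp_succ, derivOp_succ, ih, derivative_mul, h0]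
    ring

/-- The polynomial whose base `X ^ p` digits are the `r j`. -/
noncomputable def digitSum (p : ℕ) {J : ℕ} (r : Fin J → K[X]) : K[X] :=
  ∑ j : Fin J, X ^ (p * (j : ℕ)) * r j

lemma coeff_digitSum_ne_zero {p d J : ℕ} (hd : d ≤ p) {r : Fin J → K[X]}
    (hr : ∀ j, r j ∈ degreeLT K d) {n : ℕ} (h : (digitSum p r).coeff n ≠ 0) :
    n % p < d ∧ n < p * J := by
  rw [digitSum, finsetSum_coeff] at h
  obtain ⟨j, -, hj⟩ := Finset.exists_ne_zero_of_sum_ne_zero h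
  rw [coeff_X_pow_mul'] at hj
  split_ifs at hj with hle
  · have hlt : n - p * j < d := by
      by_contra hge
      exact hj (coeff_eq_zero_of_degree_lt ((mem_degreeLT.1 (hr j)).trans_le
        (by exact_mod_cast not_lt.1 hge)))
    obtain ⟨i, rfl⟩ := Nat.exists_eq_add_of_le hle
    rw [Nat.add_sub_cancel_left] at hlt
    refine ⟨by rwa [Nat.mul_add_mod, Nat.mod_eq_of_lt (by omega)], ?_⟩
    have : p * (j + 1) ≤ p * J := Nat.mul_le_mul_left _ j.2
    rw [Nat.mul_succ] at this
    omega
  · exact absurd rfl hj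

lemma natDegree_digitSum {p d J : ℕ} (hd : d ≤ p) {r : Fin J → K[X]}
    (hr : ∀ j, r j ∈ degreeLT K d) (h : digitSum p r ≠ 0) :
    (digitSum p r).natDegree % p < d ∧ (digitSum p r).natDegree < p * J :=
  coeff_digitSum_ne_zero hd hr (by simpa using h)

lemma eq_zero_of_digitSum_eq_zero {p d J : ℕ} (hd : d ≤ p) {r : Fin J → K[X]}
    (hr : ∀ j, r j ∈ degreeLT K d) (h : digitSum p r = 0) : r = 0 := by
  funext j
  ext i
  by_cases hi : i < d
  · have hc := congrArg (fun P => P.coeff (p * j + i)) h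
    simp only [digitSum, finsetSum_coeff, coeff_zero] at hc
    rw [Finset.sum_eq_single j] at hc
    · simpa [coeff_X_pow_mul'] using hc
    · intro b _ hb
      rw [coeff_X_pow_mul']
      split_ifs with hle
      · refine coeff_eq_zero_of_degree_lt ((mem_degreeLT.1 (hr b)).trans_le ?_)
        norm_cast
        have hb' : (b : ℕ) ≠ j := fun h => hb (Fin.ext h)
        rcases lt_or_gt_of_ne hb' with hlt | hgt
        · have : p * (b + 1) ≤ p * j := Nat.mul_le_mul_left _ hlt
          rw [Nat.mul_succ] at this
          omega
        · have : p * (j + 1) ≤ p * b := Nat.mul_le_mul_left _ hgt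
          rw [Nat.mul_succ] at this
          omega
      · rfl
    · simp
  · simpa using coeff_eq_zero_of_degree_lt ((mem_degreeLT.1 (hr j)).trans_le
      (by exact_mod_cast not_lt.1 hi))

/-- `A + F ^ h * B ≠ 0` since the degrees of the two terms differ modulo `p = 2 h + 1`. -/
lemma digitSum_add_ne_zero {p h J : ℕ} (hp : p = 2 * h + 1) {F : K[X]}
    (hF : F.natDegree = 3) {r s : Fin J → K[X]} (hr : ∀ j, r j ∈ degreeLT K (h - 1))
    (hs : ∀ j, s j ∈ degreeLT K (h - 1)) (hrs : ¬ (r = 0 ∧ s = 0)) :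
    digitSum p r + F ^ h * digitSum p s ≠ 0 := by
  intro h0
  have hd : h - 1 ≤ p := by omega
  have hF0 : F ≠ 0 := by rintro rfl; simp at hF
  by_cases hB : digitSum p s = 0
  · rw [hB, mul_zero, add_zero] at h0
    exact hrs ⟨eq_zero_of_digitSum_eq_zero hd hr h0, eq_zero_of_digitSum_eq_zero hd hs hB⟩
  · have hA : digitSum p r = -(F ^ h * digitSum p s) := eq_neg_of_add_eq_zero_left h0
    have hA0 : digitSum p r ≠ 0 := by
      rw [hA]; exact neg_ne_zero.2 (mul_ne_zero (pow_ne_zero _ hF0) hB)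
    have h1 := (natDegree_digitSum hd hr hA0).1
    have h2 := (natDegree_digitSum hd hs hB).1
    rw [hA, natDegree_neg, natDegree_mul (pow_ne_zero _ hF0) hB, natDegree_pow, hF] at h1
    set n := (digitSum p s).natDegree
    -- Since 3h = p + (h - 1), multiplication by F^h shifts the degree modulo p by h - 1, from [0, h
    -- - 1) to [h - 1, 2h - 2), without wrapping around. The digit bound h - 1 is chosen for this.
    have e1 : h * 3 + n = p * (n / p + 1) + (h - 1 + n % p) := by
      have := Nat.div_add_mod n p
      rw [Nat.mul_succ p]
      omega
    rw [e1, Nat.mul_add_mod, Nat.mod_eq_of_lt (by omega)] at h1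
    omega

/-- The polynomial whose values on `{F ^ h = ε}` are those of the `k`-th derivative of the
auxiliary polynomial, up to a power of `F`. -/
noncomputable def condition (F : K[X]) (ε : K) (l h J d k : ℕ) :
    ((Fin J → degreeLT K d) × (Fin J → degreeLT K d)) →ₗ[K] K[X] :=
  ∑ j : Fin J, LinearMap.mulLeft K (X ^ (j : ℕ)) ∘ₗ
    (derivOp F l k ∘ₗ (degreeLT K d).subtype ∘ₗ LinearMap.proj j ∘ₗ LinearMap.fst K _ _ +
      ε • (derivOp F (l + h) k ∘ₗ (degreeLT K d).subtype ∘ₗ LinearMap.proj j ∘ₗ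
        LinearMap.snd K _ _))

lemma condition_apply (F : K[X]) (ε : K) (l h J d k : ℕ)
    (v : (Fin J → degreeLT K d) × (Fin J → degreeLT K d)) :
    condition F ε l h J d k v = ∑ j : Fin J, X ^ (j : ℕ) *
      (derivOp F l k (v.1 j) + ε • derivOp F (l + h) k (v.2 j)) := by
  simp [condition]

lemma natDegree_condition_le {F : K[X]} (hF : F.natDegree ≤ 3) (ε : K) (l h J d k : ℕ)
    (v : (Fin J → degreeLT K d) × (Fin J → degreeLT K d)) :
    (condition F ε l h J d k v).natDegree ≤ J + d + 2 * k := by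
  have hdeg : ∀ P : degreeLT K d, (P : K[X]).natDegree ≤ d := fun P =>
    natDegree_le_of_degree_le (mem_degreeLT.1 P.2).le
  rw [condition_apply]
  refine natDegree_sum_le_of_forall_le _ _ fun j _ => natDegree_mul_le.trans ?_
  rw [natDegree_X_pow]
  have h1 := natDegree_derivOp_le hF l (hdeg (v.1 j)) k
  have h2 := natDegree_derivOp_le hF (l + h) (hdeg (v.2 j)) k
  have h3 := natDegree_add_le_of_degree_le h1 ((natDegree_smul_le ε _).trans h2)
  have := j.2
  omega

lemma finrank_degreeLT (d : ℕ) : Module.finrank K (degreeLT K d) = d := by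
  rw [(degreeLTEquiv K d).finrank_eq]; simp

instance (d : ℕ) : FiniteDimensional K (degreeLT K d) :=
  Module.Finite.equiv (degreeLTEquiv K d).symm

/-- Dimension count: the digits give 2Jd unknowns, and each of the l conditions is a polynomial of
degree less than J + d + 2l, hence that many linear equations. -/
lemma exists_condition_eq_zero {F : K[X]} (hF : F.natDegree ≤ 3) (ε : K) {l h J d : ℕ}
    (hcount : l * (J + d + 2 * l) < 2 * (J * d)) :
    ∃ v, v ≠ 0 ∧ ∀ k < l, condition F ε l h J d k v = 0 := by
  let Φ : ((Fin J → degreeLT K d) × (Fin J → degreeLT K d)) →ₗ[K]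
      (Fin l → Fin (J + d + 2 * l) → K) :=
    LinearMap.pi fun k => LinearMap.pi fun i => lcoeff K i ∘ₗ condition F ε l h J d k
  have hker : LinearMap.ker Φ ≠ ⊥ := by
    apply LinearMap.ker_ne_bot_of_finrank_lt
    simp only [Module.finrank_prod, Module.finrank_pi_fintype, finrank_degreeLT,
      Module.finrank_self, Finset.sum_const, Finset.card_univ, Fintype.card_fin, smul_eq_mul,
      mul_one]
    omega
  obtain ⟨v, hv, hv0⟩ := (Submodule.ne_bot_iff _).1 hker
  refine ⟨v, hv0, fun k hk => ?_⟩
  ext i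
  by_cases hi : i < J + d + 2 * l
  · exact congrFun (congrFun (LinearMap.mem_ker.1 hv) ⟨k, hk⟩) ⟨i, hi⟩
  · rw [coeff_zero]
    apply coeff_eq_zero_of_natDegree_lt
    have := natDegree_condition_le hF ε l h J d k v
    omega

/-- At the points being counted, F^h may be replaced by ε and X^(pj) by X^j, so the vanishing of
`condition` forces the k-th derivative to vanish there. -/
lemma eval_iterate_derivative_auxiliary {p : ℕ} [CharP K p] {F : K[X]} {x ε : K}
    {l h J d k : ℕ} (hk : k ≤ l) (hx : x ^ p = x) (hε : F.eval x ^ h = ε)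
    (v : (Fin J → degreeLT K d) × (Fin J → degreeLT K d)) :
    (derivative^[k] (F ^ l * digitSum p (fun j => (v.1 j : K[X])) +
      F ^ (l + h) * digitSum p (fun j => (v.2 j : K[X])))).eval x =
      F.eval x ^ (l - k) * (condition F ε l h J d k v).eval x := by
  have hT : ∀ (e : ℕ) (r : Fin J → K[X]), (derivOp F e k (digitSum p r)).eval x =
      ∑ j : Fin J, x ^ (j : ℕ) * (derivOp F e k (r j)).eval x := by
    intro e r
    simp only [digitSum, map_sum, eval_finsetSum, derivOp_X_pow_mul, eval_mul, eval_pow, eval_X]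
    simp only [pow_mul, hx]
  have hlk : l + h - k = (l - k) + h := by omega
  rw [iterate_map_add, iterate_derivative_pow_mul _ _ _ hk,
    iterate_derivative_pow_mul _ _ _ (hk.trans (Nat.le_add_right l h)), hlk, eval_add, eval_mul,
    eval_mul, hT, hT, condition_apply, eval_finsetSum, eval_pow, eval_pow, pow_add, hε, mul_assoc,
    ← mul_add, Finset.mul_sum, ← Finset.sum_add_distrib]
  congr 1
  refine Finset.sum_congr rfl fun j _ => ?_
  simp only [eval_mul, eval_add, eval_smul, eval_pow, eval_X, smul_eq_mul]
  ring

lemma card_mul_le_natDegree {S : Finset K} {R : K[X]} {l : ℕ}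
    (hS : ∀ x ∈ S, l ≤ R.rootMultiplicity x) : S.card * l ≤ R.natDegree := by
  classical
  have hle : l • S.val ≤ R.roots := by
    rw [Multiset.le_iff_count]
    intro x
    rw [Multiset.count_nsmul, count_roots]
    by_cases hx : x ∈ S
    · rw [Multiset.count_eq_one_of_mem S.nodup hx, mul_one]; exact hS x hx
    · rw [Multiset.count_eq_zero_of_notMem (by simpa using hx)]; simp
  have := (Multiset.card_le_card hle).trans (card_roots' R)
  rw [Multiset.card_nsmul] at this
  simpa [mul_comm] using this

/-- **Stepanov's bound** for a cubic over a field with `p` elements. -/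
theorem card_mul_le [Fintype K] [DecidableEq K] {p h m : ℕ} (hK : Fintype.card K = p)
    (hprime : p.Prime) (hp : p = 2 * h + 1) (hm : 0 < m) (hmp : 10 * m ^ 2 + 2 * m + 2 < 2 * h)
    {F : K[X]} (hF : F.natDegree = 3) (ε : K) :
    (Finset.univ.filter fun x : K => F.eval x ^ h = ε).card * (2 * m) ≤ (m + 2) * p + 6 * m := by
  have : Fact p.Prime := ⟨hprime⟩
  have : CharP K p := charP_of_card_eq_prime hK
  -- The parameters are l = 2m, J = m + 1 and d = h - 1. The terms 2mh cancel, and what remains is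
  -- exactly `hmp`.
  have hcount : 2 * m * (m + 1 + (h - 1) + 2 * (2 * m)) < 2 * ((m + 1) * (h - 1)) := by
    obtain ⟨d, rfl⟩ : ∃ d, h = d + 1 := ⟨h - 1, by omega⟩
    simp only [Nat.add_sub_cancel]
    nlinarith
  obtain ⟨v, hv0, hv⟩ := exists_condition_eq_zero (h := h) hF.le ε hcount
  set r : Fin (m + 1) → K[X] := fun j => (v.1 j : K[X]) with hr
  set s : Fin (m + 1) → K[X] := fun j => (v.2 j : K[X]) with hs
  have hrm : ∀ j, r j ∈ degreeLT K (h - 1) := fun j => (v.1 j).2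
  have hsm : ∀ j, s j ∈ degreeLT K (h - 1) := fun j => (v.2 j).2
  have hF0 : F ≠ 0 := by rintro rfl; simp at hF
  have hne : digitSum p r + F ^ h * digitSum p s ≠ 0 := by
    refine digitSum_add_ne_zero hp hF hrm hsm fun ⟨h1, h2⟩ => hv0 ?_
    ext j : 2
    · exact Subtype.ext (congrFun h1 j)
    · exact Subtype.ext (congrFun h2 j)
  set R := F ^ (2 * m) * digitSum p r + F ^ (2 * m + h) * digitSum p s with hRdef
  have hR : R = F ^ (2 * m) * (digitSum p r + F ^ h * digitSum p s) := by
    rw [hRdef]; ring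
  have hR0 : R ≠ 0 := by rw [hR]; exact mul_ne_zero (pow_ne_zero _ hF0) hne
  -- The contributions are 6m from F^(2m), 3h from F^h and pm + h - 1 from the digit sums; 4h - 1 ≤
  -- 2p.
  have hdeg : R.natDegree ≤ (m + 2) * p + 6 * m := by
    have hd : h - 1 ≤ p := by omega
    have hD : ∀ t : Fin (m + 1) → K[X], (∀ j, t j ∈ degreeLT K (h - 1)) →
        (digitSum p t).natDegree ≤ p * m + (h - 1) := by
      intro t ht
      by_cases h0 : digitSum p t = 0
      · simp [h0]
      · obtain ⟨h1, h2⟩ := natDegree_digitSum hd ht h0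
        have h3 : (digitSum p t).natDegree / p ≤ m :=
          Nat.lt_succ_iff.1 (Nat.div_lt_of_lt_mul h2)
        have h4 := Nat.div_add_mod (digitSum p t).natDegree p
        have h5 := Nat.mul_le_mul_left p h3
        omega
    have h1 := hD r hrm
    have h2 := hD s hsm
    have h3 : (F ^ h * digitSum p s).natDegree ≤ h * 3 + (p * m + (h - 1)) := by
      refine natDegree_mul_le.trans ?_
      rw [natDegree_pow, hF]; omega
    have h4 := natDegree_add_le_of_degree_le
      (h1.trans (by omega : _ ≤ h * 3 + (p * m + (h - 1)))) h3
    rw [hR]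
    refine natDegree_mul_le.trans ?_
    rw [natDegree_pow, hF]
    have : (m + 2) * p = p * m + 2 * p := by ring
    omega
  refine (card_mul_le_natDegree fun x hx => ?_).trans hdeg
  have hx' : F.eval x ^ h = ε := (Finset.mem_filter.1 hx).2
  have hlt : 2 * m - 1 < R.rootMultiplicity x := by
    -- In characteristic p vanishing derivatives detect multiplicity only up to order p; here the
    -- order 2m stays below p.
    refine lt_rootMultiplicity_of_isRoot_iterate_derivative_of_mem_nonZeroDivisors' hR0 ?_ ?_
    · intro k hk
      rw [IsRoot, hRdef, eval_iterate_derivative_auxiliary (by omega)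
        (by rw [← hK, FiniteField.pow_card]) hx' v, hv k (by omega), eval_zero, mul_zero]
    · intro k hk hk0
      refine mem_nonZeroDivisors_of_ne_zero fun h0 => ?_
      have := Nat.le_of_dvd (Nat.pos_of_ne_zero hk0) ((CharP.cast_eq_zero_iff K p k).1 h0)
      have : k < 2 * m := by omega
      nlinarith
  omega

end Stepanov

namespace WeierstrassCurve

open Polynomial

/-! ### Point counts as quadratic character sums. -/

section PointCount

variable {K : Type*} [Field K] [Fintype K]

open Classical in
lemma natCard_point_eq (W : WeierstrassCurve K) [W.IsElliptic] :
    Nat.card W.toAffine.Point =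
      (Finset.univ.filter fun xy : K × K => W.toAffine.Equation xy.1 xy.2).card + 1 := by
  rw [Nat.card_congr (Affine.pointEquiv (W' := W.toAffine)), WithZero, Finite.card_option,
    Nat.card_eq_fintype_card, Fintype.card_subtype]

open Classical in
-- Completing the square, y ↦ 2y + a₁x + a₃ matches the points above x with the square roots of the
-- two-torsion cubic at x.
lemma card_equation_eq_sum [DecidableEq K] (hK : ringChar K ≠ 2) (W : WeierstrassCurve K) :
    ((Finset.univ.filter fun xy : K × K => W.toAffine.Equation xy.1 xy.2).card : ℤ) =
      ∑ x, (quadraticChar K (W.twoTorsionPolynomial.toPoly.eval x) + 1) := by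
  have h2 : (2 : K) ≠ 0 := Ring.two_ne_zero hK
  rw [Finset.card_filter, ← Finset.univ_product_univ, Finset.sum_product, Nat.cast_sum]
  refine Finset.sum_congr rfl fun x _ => ?_
  rw [← Finset.card_filter, ← quadraticChar_card_sqrts hK]
  norm_cast
  have key : ∀ y, W.toAffine.Equation x y ↔
      (2 * y + (W.a₁ * x + W.a₃)) ^ 2 = W.twoTorsionPolynomial.toPoly.eval x := by
    intro y
    rw [Affine.equation_iff, ← sub_eq_zero, ← sub_eq_zero (a := _ ^ 2), ← mul_right_inj' h2,
      ← mul_right_inj' h2, mul_zero, mul_zero]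
    simp only [twoTorsionPolynomial, Cubic.toPoly, eval_add, eval_mul, eval_C, eval_pow, eval_X,
      b₂, b₄, b₆]
    constructor <;> intro h <;> linear_combination h
  refine Finset.card_nbij' (fun y => 2 * y + (W.a₁ * x + W.a₃))
    (fun z => (z - (W.a₁ * x + W.a₃)) / 2) ?_ ?_ ?_ ?_
  · intro y hy
    simpa using (key y).1 (by simpa using hy)
  · intro z hz
    have hz' : z ^ 2 = W.twoTorsionPolynomial.toPoly.eval x := by simpa using hz
    simp only [Finset.coe_filter, Finset.mem_univ, true_and, Set.mem_ofPred_eq]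
    rw [key, mul_div_cancel₀ _ h2, sub_add_cancel, hz']
  · intro y _
    field_simp
    ring
  · intro z _
    field_simp
    ring

end PointCount

end WeierstrassCurve

namespace Stepanov

open Polynomial

/-! ### The character sum bound. -/

variable {K : Type*} [Field K] [Fintype K] [DecidableEq K]

/-- By Euler's criterion the sum is N₊ - N₋, the counts for ε = ±1, while N₊ + N₋ + N₀ = p with N₀ ≤
3. Upper bounds for both counts therefore suffice: N₊ - N₋ = 2N₊ - p + N₀, and symmetrically. -/
lemma abs_sum_quadraticChar_mul_le {p h m : ℕ} (hK : Fintype.card K = p)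
    (hprime : p.Prime) (hp : p = 2 * h + 1) (hm : 0 < m) (hmp : 10 * m ^ 2 + 2 * m + 2 < 2 * h)
    {F : K[X]} (hF : F.natDegree = 3) :
    |∑ x, quadraticChar K (F.eval x)| * m ≤ 2 * p + 9 * m := by
  have : Fact p.Prime := ⟨hprime⟩
  have : CharP K p := charP_of_card_eq_prime hK
  have hchar : ringChar K ≠ 2 := by rw [ringChar.eq K p]; omega
  have hF0 : F ≠ 0 := by rintro rfl; simp at hF
  have hone : (1 : K) ≠ -1 := (Ring.neg_one_ne_one_of_char_ne_two hchar).symm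
  have hpow : ∀ a : K, a ^ h = (quadraticChar K a : K) := fun a => by
    rw [quadraticChar_eq_pow_of_char_ne_two' hchar, hK]
    congr 1; omega
  have hbound := card_mul_le hK hprime hp hm hmp hF
  have hzero : (Finset.univ.filter fun x : K => F.eval x = 0).card ≤ 3 := by
    rw [← hF]
    refine le_trans (Finset.card_le_card ?_)
      ((Multiset.toFinset_card_le F.roots).trans (card_roots' F))
    intro x hx
    rw [Multiset.mem_toFinset, mem_roots hF0]
    simpa using hx
  have hsplit : ∀ a : K, quadraticChar K a = (if a ^ h = 1 then 1 else 0) -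
      (if a ^ h = -1 then 1 else 0) ∧
      (1 : ℤ) = (if a ^ h = 1 then 1 else 0) + (if a ^ h = -1 then 1 else 0) +
        (if a = 0 then 1 else 0) := by
    intro a
    rw [hpow]
    by_cases ha : a = 0
    · subst ha
      simp
    · rcases quadraticChar_dichotomy ha with h1 | h1 <;> rw [h1] <;> simp [ha, hone, hone.symm]
  have hT : ∑ x, quadraticChar K (F.eval x) =
      ((Finset.univ.filter fun x : K => F.eval x ^ h = 1).card : ℤ) -
        (Finset.univ.filter fun x : K => F.eval x ^ h = -1).card := by
    rw [Finset.natCast_card_filter, Finset.natCast_card_filter, ← Finset.sum_sub_distrib]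
    exact Finset.sum_congr rfl fun x _ => (hsplit _).1
  have hP : (p : ℤ) = (Finset.univ.filter fun x : K => F.eval x ^ h = 1).card +
        (Finset.univ.filter fun x : K => F.eval x ^ h = -1).card +
        (Finset.univ.filter fun x : K => F.eval x = 0).card := by
    rw [Finset.natCast_card_filter, Finset.natCast_card_filter, Finset.natCast_card_filter,
      ← Finset.sum_add_distrib, ← Finset.sum_add_distrib, ← hK, ← Finset.card_univ,
      Finset.card_eq_sum_ones, Nat.cast_sum]
    exact Finset.sum_congr rfl fun x _ => by rw [Nat.cast_one]; exact (hsplit _).2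
  have h1 := hbound 1
  have h2 := hbound (-1)
  rw [hT]
  zify at h1 h2 hzero hm
  rcases abs_cases (((Finset.univ.filter fun x : K => F.eval x ^ h = 1).card : ℤ) -
        (Finset.univ.filter fun x : K => F.eval x ^ h = -1).card) with ⟨h3, -⟩ | ⟨h3, -⟩ <;>
  · rw [h3]
    nlinarith

end Stepanov

/-! ### A weak Hasse bound. -/

namespace WeierstrassCurve

/-- Hasse's bound, with a weaker constant, over a field with a prime number of elements. -/
theorem abs_card_add_one_sub_natCard_point_le {K : Type*} [Field K] [Fintype K] {p : ℕ}
    (hK : Fintype.card K = p) (hprime : p.Prime) (W : WeierstrassCurve K) [W.IsElliptic] :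
    |(p : ℝ) + 1 - Nat.card W.toAffine.Point| ≤ 64 * √p := by
  classical
  have hp0 : (0 : ℝ) ≤ p := Nat.cast_nonneg p
  have hs := Real.sq_sqrt hp0
  have hs0 := Real.sqrt_nonneg (p : ℝ)
  rw [natCard_point_eq]
  -- For p < 16 the trivial count N ≤ p² = √p³ √p is enough, and 4³ = 64 fixes the constant. For p ≥
  -- 16 the integer square root s is at least 4, so m = s / 4 is positive.
  rcases lt_or_ge p 16 with hlt | hge
  · set N := (Finset.univ.filter fun xy : K × K => W.toAffine.Equation xy.1 xy.2).card
    have hN : N ≤ p * p := by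
      refine (Finset.card_le_univ _).trans ?_
      rw [Fintype.card_prod, hK]
    have hN' : (N : ℝ) ≤ p * p := by exact_mod_cast hN
    have hN0 : (0 : ℝ) ≤ N := Nat.cast_nonneg N
    have h1 : (1 : ℝ) ≤ p := by exact_mod_cast hprime.one_lt.le
    have h4 : √(p : ℝ) ≤ 4 := by
      rw [Real.sqrt_le_left (by norm_num)]
      have : (p : ℝ) < 16 := by exact_mod_cast hlt
      linarith
    have h3 : √(p : ℝ) ^ 3 ≤ 4 ^ 3 := by gcongr
    have h5 : (p : ℝ) * p ≤ 64 * √p := by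
      calc (p : ℝ) * p = √(p : ℝ) ^ 3 * √p := by nth_rw 1 2 [← hs]; ring
        _ ≤ 64 * √p := by gcongr; linarith
    push_cast
    rw [abs_le]
    constructor <;> nlinarith
  · obtain ⟨h, hp⟩ : ∃ h, p = 2 * h + 1 := hprime.odd_of_ne_two (by omega)
    have : Fact p.Prime := ⟨hprime⟩
    have : CharP K p := charP_of_card_eq_prime hK
    have hchar : ringChar K ≠ 2 := by rw [ringChar.eq K p]; omega
    have h4 : (4 : K) ≠ 0 := by
      have : (4 : K) = 2 * 2 := by norm_num
      rw [this]
      exact mul_ne_zero (Ring.two_ne_zero hchar) (Ring.two_ne_zero hchar)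
    have hF : W.twoTorsionPolynomial.toPoly.natDegree = 3 := Cubic.natDegree_of_a_ne_zero' h4
    set s := p.sqrt with hsdef
    have hs1 : s * s ≤ p := Nat.sqrt_le p
    have hs2 : p ≤ s * s + s + s := Nat.sqrt_le_add p
    have hs4 : 4 ≤ s := Nat.le_sqrt.2 (by omega)
    -- With m ≤ √p / 4 one has 10m² ≤ 5p/8, which leaves room below 2h = p - 1 for the lower order
    -- terms.
    obtain ⟨m, hm⟩ : ∃ m, m = s / 4 := ⟨_, rfl⟩
    have hm1 : 1 ≤ m := by omega
    have hm4 : 4 * m ≤ s := by omega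
    have hm7 : s ≤ 7 * m := by omega
    have hmain := Stepanov.abs_sum_quadraticChar_mul_le hK hprime hp hm1 (by nlinarith) hF
    have hcard := card_equation_eq_sum hchar W
    rw [Finset.sum_add_distrib, Finset.sum_const, Finset.card_univ, hK, nsmul_one] at hcard
    set T := ∑ x, quadraticChar K (W.twoTorsionPolynomial.toPoly.eval x)
    have hT : |T| ≤ 27 * s := by
      zify at hm1 hm7 hs2 hs4
      -- From p ≤ s(s + 2) and s + 2 ≤ 9m. Hence |T| m ≤ 18sm + 9m, so |T| ≤ 18s + 9 ≤ 27s.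
      have h7 : (p : ℤ) ≤ s * (9 * m) := by nlinarith
      by_contra! hcon
      nlinarith
    have hsR : (s : ℝ) ≤ √p := Real.nat_sqrt_le_real_sqrt
    have hTR : |(T : ℝ)| ≤ 27 * s := by exact_mod_cast hT
    have hcardR := congrArg (Int.cast : ℤ → ℝ) hcard
    push_cast at hcardR ⊢
    rw [hcardR]
    have : (p : ℝ) + 1 - (T + p + 1) = -T := by ring
    rw [this, abs_neg]
    linarith

end WeierstrassCurve

/-! ### The bound for Frobenius traces. -/

namespace RSCO

open Polynomial in
/-- Hasse's bound, with a weaker constant, for the Frobenius traces of `E`. -/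
theorem abs_frobeniusTrace_le (E : WeierstrassCurve ℚ) (p : ℕ) :
    |(frobeniusTrace E p : ℝ)| ≤ 64 * √p := by
  classical
  by_cases hp : p.Prime
  · have : Fact p.Prime := ⟨hp⟩
    have h1 : (1 : ℝ) ≤ √p := Real.one_le_sqrt.2 (by exact_mod_cast hp.one_lt.le)
    simp only [frobeniusTrace, hp, dif_pos, WeierstrassCurve.localPolynomial]
    split_ifs with hgood hsplit hmult
    · have e : IsLocalRing.ResidueField ℤ_[p] ≃ ZMod p := PadicInt.residueField.toEquiv
      let _ : Fintype (IsLocalRing.ResidueField ℤ_[p]) := Fintype.ofEquiv _ e.symm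
      have hcard : Fintype.card (IsLocalRing.ResidueField ℤ_[p]) = p := by
        rw [Fintype.card_congr e, ZMod.card]
      have : (((E.baseChange ℚ_[p]).minimal ℤ_[p]).reduction ℤ_[p]).IsElliptic :=
        (WeierstrassCurve.hasGoodReduction_iff_isElliptic_reduction ℤ_[p]).1 hgood
      have := WeierstrassCurve.abs_card_add_one_sub_natCard_point_le hcard hp
        (((E.baseChange ℚ_[p]).minimal ℤ_[p]).reduction ℤ_[p])
      simpa [coeff_one, coeff_X, coeff_C, hcard] using this
    · simp [coeff_one, coeff_X]; linarith
    · simp [coeff_one, coeff_X]; linarith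
    · simp [coeff_one]
  · simp [frobeniusTrace, hp]

end RSCO

/-! ### Finiteness of the set of bad primes. -/

namespace WeierstrassCurve

open IsDedekindDomain.HeightOneSpectrum

/-- A minimal model of a curve with an integral equation of unit discriminant has good
reduction. -/
lemma hasGoodReduction_minimal {R K : Type*} [CommRing R] [IsDomain R]
    [IsDiscreteValuationRing R] [Field K] [Algebra R K] [IsFractionRing R K]
    (W : WeierstrassCurve K) [IsIntegral R W]
    (hΔ : valuation K (IsDiscreteValuationRing.maximalIdeal R) W.Δ = 1) :
    (W.minimal R).HasGoodReduction R := by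
  refine ⟨?_⟩
  set C := (W.exists_isMinimal R).choose
  have hmin : W.minimal R = C • W := rfl
  have hC : C⁻¹ • W.minimal R = W := by rw [hmin, inv_smul_smul]
  have hint : IsIntegral R (C⁻¹ • W.minimal R) := by rw [hC]; infer_instance
  -- The valuation is multiplicative, so minimality makes the value of Δ largest. It is at least
  -- that of `W`, which is 1, and at most 1 by integrality.
  have hmax := (IsMinimal.val_Δ_maximal (R := R) (W := W.minimal R)).2 hint
  simp only [one_smul, hC] at hmax
  have hle : valuation_Δ_aux R W ≤ valuation_Δ_aux R (W.minimal R) :=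
    (le_total _ _).elim hmax id
  rw [← Subtype.coe_le_coe, valuation_Δ_aux_eq_of_isIntegral, valuation_Δ_aux_eq_of_isIntegral,
    hΔ] at hle
  refine le_antisymm ?_ hle
  rw [← valuation_Δ_aux_eq_of_isIntegral]
  exact (valuation_Δ_aux R (W.minimal R)).2

end WeierstrassCurve

namespace RSCO

lemma finite_not_goodAt (E : WeierstrassCurve ℚ) [E.IsElliptic] :
    {p : ℕ | p.Prime ∧ ¬ GoodAt E p}.Finite := by
  -- Away from the primes dividing D the given equation is p-integral, and Δ and its inverse are
  -- too, so Δ is a p-adic unit.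
  set D : ℕ := E.a₁.den * E.a₂.den * E.a₃.den * E.a₄.den * E.a₆.den * E.Δ.den * E.Δ⁻¹.den
  have hD : D ≠ 0 := by
    simp only [D, ne_eq, mul_eq_zero, Rat.den_ne_zero, or_self, not_false_eq_true]
  refine (D.primeFactors.finite_toSet).subset ?_
  rintro p ⟨hp, hbad⟩
  by_contra hmem
  have hpD : ¬ p ∣ D := fun h => hmem (by simp [hp, h, hD])
  simp only [D, hp.dvd_mul, not_or] at hpD
  obtain ⟨⟨⟨⟨⟨⟨h1, h2⟩, h3⟩, h4⟩, h6⟩, hd⟩, hd'⟩ := hpD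
  have : Fact p.Prime := ⟨hp⟩
  have lift : ∀ {q : ℚ}, ¬ p ∣ q.den → ∃ r : ℤ_[p], algebraMap ℤ_[p] ℚ_[p] r = (q : ℚ_[p]) :=
    fun h => ⟨⟨_, Padic.norm_rat_le_one h⟩, rfl⟩
  have hΔ0 : E.Δ ≠ 0 := E.isUnit_Δ.ne_zero
  have hint : (E.baseChange ℚ_[p]).IsIntegral ℤ_[p] :=
    WeierstrassCurve.isIntegral_of_exists_lift ℤ_[p] (by simpa using lift h1)
      (by simpa using lift h2) (by simpa using lift h3) (by simpa using lift h4)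
      (by simpa using lift h6)
  refine hbad ⟨hp, WeierstrassCurve.hasGoodReduction_minimal _ ?_⟩
  obtain ⟨r, hr⟩ := lift hd
  obtain ⟨r', hr'⟩ := lift hd'
  have hrr : IsUnit r := by
    refine IsUnit.of_mul_eq_one r' (FaithfulSMul.algebraMap_injective ℤ_[p] ℚ_[p] ?_)
    rw [map_mul, hr, hr', map_one, ← Rat.cast_mul, mul_inv_cancel₀ hΔ0, Rat.cast_one]
  have hΔ : (E.baseChange ℚ_[p]).Δ = algebraMap ℤ_[p] ℚ_[p] r := by
    rw [hr, WeierstrassCurve.baseChange, WeierstrassCurve.map_Δ, eq_ratCast]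
  rw [hΔ, IsDedekindDomain.HeightOneSpectrum.valuation_eq_one_iff_notMem]
  exact fun h => (IsLocalRing.mem_maximalIdeal r).1 h hrr

end RSCO

/-! ### Distance of the basepoint from (1, 1). -/

namespace RSCO

open Filter

/-- Valid also for y < 0, where `√y` is 0. The weak Hasse constant does not give positivity of the
radicand or of w_p at small p, and this makes positivity unnecessary. -/
lemma abs_sqrt_sub_one_le (y : ℝ) : |√y - 1| ≤ |y - 1| := by
  rcases le_total 0 y with h | h
  · have hs := Real.sqrt_nonneg y
    have : y - 1 = (√y - 1) * (√y + 1) := by nlinarith [Real.sq_sqrt h]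
    rw [this, abs_mul, abs_of_nonneg (by linarith : 0 ≤ √y + 1)]
    exact le_mul_of_one_le_right (abs_nonneg _) (by linarith)
  · rw [Real.sqrt_eq_zero_of_nonpos h, abs_of_nonpos (by linarith), abs_of_nonpos (by linarith)]
    linarith

/-- For x < 0 both sides are 0: the real power carries the factor cos(3π/2). -/
lemma rpow_three_halves (x : ℝ) : x ^ (3 / 2 : ℝ) = x * √x := by
  rcases le_total 0 x with h | h
  · rw [Real.sqrt_eq_rpow, ← Real.rpow_one_add' h (by norm_num)]
    norm_num
  · rw [Real.sqrt_eq_zero_of_nonpos h, mul_zero]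
    rcases h.eq_or_lt with rfl | h
    · exact Real.zero_rpow (by norm_num)
    · rw [Real.rpow_def_of_neg h]
      have : (3 / 2 : ℝ) * Real.pi = Real.pi / 2 + Real.pi := by ring
      rw [this, Real.cos_add_pi, Real.cos_pi_div_two]
      simp

lemma basepointW_eq (E : WeierstrassCurve ℚ) {p : ℕ} (hp : 0 < p) : basepointW E p = (frobeniusTrace E p : ℝ) / (2 * p) +
    √(1 + 1 / p - ((frobeniusTrace E p : ℝ) / (2 * p)) ^ 2) := by
  have hp' : (0 : ℝ) < p := by exact_mod_cast hp
  have h2 : (2 * p : ℝ) = √((2 * p) ^ 2) := (Real.sqrt_sq (by positivity)).symm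
  rw [basepointW, add_div]
  congr 1
  nth_rw 1 [h2]
  rw [← Real.sqrt_div' _ (by positivity)]
  congr 1
  field_simp
  ring

/-- Factoring out √w_p leaves w_p - a_p/(2p), which is the radical in w_p. -/
lemma basepointLambda_eq (E : WeierstrassCurve ℚ) {p : ℕ} (hp : 0 < p) : basepointLambda E p = basepointU E p *
    √(1 + 1 / p - ((frobeniusTrace E p : ℝ) / (2 * p)) ^ 2) := by
  rw [basepointLambda, rpow_three_halves, ← Real.sqrt_eq_rpow, ← sub_mul, basepointU,
    mul_comm]
  nth_rw 2 [basepointW_eq E hp]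
  rw [add_sub_cancel_left]

lemma abs_frobeniusTrace_div_le (E : WeierstrassCurve ℚ) {p : ℕ} (hp : 0 < p) : |(frobeniusTrace E p : ℝ) / (2 * p)| ≤ 32 / √p := by
  have hp' : (0 : ℝ) < p := by exact_mod_cast hp
  have hs : 0 < √(p : ℝ) := Real.sqrt_pos.2 hp'
  have h := abs_frobeniusTrace_le E p
  rw [abs_div, abs_of_pos (by positivity : (0 : ℝ) < 2 * p), div_le_div_iff₀ (by positivity) hs]
  calc _ ≤ 64 * √p * √p := by gcongr
    _ = 32 * (2 * p) := by rw [mul_assoc, Real.mul_self_sqrt hp'.le]; ring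

lemma abs_sqrt_radicand_sub_one_le (E : WeierstrassCurve ℚ) {p : ℕ} (hp : 0 < p) :
    |√(1 + 1 / p - ((frobeniusTrace E p : ℝ) / (2 * p)) ^ 2) - 1| ≤ 1025 / √p := by
  have hp' : (1 : ℝ) ≤ p := by exact_mod_cast hp
  have hs : 1 ≤ √(p : ℝ) := Real.one_le_sqrt.2 hp'
  have hinv : 1 / (p : ℝ) ≤ 1 / √p := by
    rw [div_le_div_iff₀ (by linarith) (by linarith)]
    nlinarith [Real.mul_self_sqrt (by linarith : (0 : ℝ) ≤ p)]
  have ht : ((frobeniusTrace E p : ℝ) / (2 * p)) ^ 2 ≤ 1024 * (1 / p) := by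
    rw [← sq_abs]
    calc _ ≤ (32 / √(p : ℝ)) ^ 2 := by gcongr; exact abs_frobeniusTrace_div_le E hp
      _ = _ := by rw [div_pow, Real.sq_sqrt (by linarith)]; ring
  have ht0 := sq_nonneg ((frobeniusTrace E p : ℝ) / (2 * p))
  have h0 : 0 ≤ 1 / (p : ℝ) := by positivity
  refine (abs_sqrt_sub_one_le _).trans ?_
  have : 1025 / √(p : ℝ) = 1025 * (1 / √p) := by ring
  rw [this, abs_le]
  -- 1025 = 1 + 32²: the term 1/p and the square of a_p/(2p), with 1/p ≤ 1/√p.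
  constructor <;> linarith

lemma abs_basepointU_sub_one_le (E : WeierstrassCurve ℚ) {p : ℕ} (hp : 0 < p) : |basepointU E p - 1| ≤ 1057 / √p := by
  refine (abs_sqrt_sub_one_le _).trans ?_
  rw [basepointW_eq E hp, add_sub_assoc]
  refine (abs_add_le _ _).trans ?_
  have h1 := abs_frobeniusTrace_div_le E hp
  have h2 := abs_sqrt_radicand_sub_one_le E hp
  have : 1057 / √(p : ℝ) = 32 / √p + 1025 / √p := by ring
  linarith

lemma abs_basepointLambda_sub_one_le (E : WeierstrassCurve ℚ) {p : ℕ} (hp : 0 < p) : |basepointLambda E p - 1| ≤ 1085507 / √p := by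
  have hs : 1 ≤ √(p : ℝ) := Real.one_le_sqrt.2 (by exact_mod_cast hp)
  rw [basepointLambda_eq E hp]
  set s := √(1 + 1 / p - ((frobeniusTrace E p : ℝ) / (2 * p)) ^ 2)
  have h1 := abs_basepointU_sub_one_le E hp
  have h2 : |s - 1| ≤ 1025 / √p := abs_sqrt_radicand_sub_one_le E hp
  have hs0 : 0 ≤ s := Real.sqrt_nonneg _
  have hs1 : s ≤ 1026 := by
    have h3 : 1025 / √(p : ℝ) ≤ 1025 := div_le_self (by norm_num) hs
    linarith [le_abs_self (s - 1)]
  have : basepointU E p * s - 1 = (basepointU E p - 1) * s + (s - 1) := by ring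
  rw [this]
  refine (abs_add_le _ _).trans ?_
  rw [abs_mul, abs_of_nonneg hs0]
  calc _ ≤ 1057 / √(p : ℝ) * 1026 + 1025 / √p := by gcongr
    _ = _ := by ring

/-! ### Chebyshev estimates. -/

section Primes

open Chebyshev

lemma sum_log_primesUpTo (X : ℝ) : ∑ p ∈ primesUpTo X, Real.log p = θ X := rfl

/-- For large X the logarithmic error terms are absorbed using log X ≤ √X / 10. On the remaining
bounded range [2, Z] the bound θ(X) ≥ θ(2) = log 2 suffices after shrinking c. -/
lemma exists_mul_le_theta : ∃ c : ℝ, 0 < c ∧ ∀ X : ℝ, 2 ≤ X → c * X ≤ θ X := by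
  have hlog : ∀ᶠ x : ℝ in atTop, Real.log x ≤ 1 / 10 * √x := by
    have h := (isLittleO_log_rpow_atTop (r := 1 / 2) (by norm_num)).bound
      (by norm_num : (0 : ℝ) < 1 / 10)
    filter_upwards [h, eventually_ge_atTop 1] with x hx hx1
    rw [← Real.sqrt_eq_rpow, Real.norm_of_nonneg (Real.log_nonneg hx1),
      Real.norm_of_nonneg (Real.sqrt_nonneg _)] at hx
    exact hx
  obtain ⟨Y, hY⟩ := eventually_atTop.1
    (hlog.and (eventually_ge_atTop (10 : ℝ)))
  have hlarge : ∀ X, Y ≤ X → 1 / 10 * X ≤ θ X := by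
    intro X hX
    obtain ⟨h1, h2⟩ := hY X hX
    have h0 : 0 ≤ X := by linarith
    have hs := Real.mul_self_sqrt h0
    have hs0 := Real.sqrt_nonneg X
    have hs1 : √X ≤ X := by
      rw [Real.sqrt_le_left h0]; nlinarith
    have h3 : Real.log (X + 2) ≤ 2 * Real.log X := by
      rw [← Real.log_rpow (by linarith)]
      apply Real.log_le_log (by linarith)
      norm_num
      nlinarith
    have h4 : √X * Real.log X ≤ √X * (1 / 10 * √X) := by gcongr
    have h5 := theta_ge' (x := X) (by linarith)
    have h6 := Real.log_two_gt_d9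
    have h7 := Real.log_two_lt_d9
    nlinarith
  set Z := max Y 10
  have hZ : 10 ≤ Z := le_max_right _ _
  have hl2 := Real.log_pos one_lt_two
  refine ⟨min (1 / 10) (Real.log 2 / Z), by positivity, fun X hX => ?_⟩
  rcases le_total Z X with h | h
  · refine le_trans ?_ (hlarge X ((le_max_left _ _).trans h))
    gcongr
    exact min_le_left _ _
  · calc min (1 / 10) (Real.log 2 / Z) * X ≤ Real.log 2 / Z * Z := by
          gcongr
          exact min_le_right _ _
      _ = Real.log 2 := by field_simp
      _ = θ 2 := by
          rw [theta_eq_log_primorial]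
          norm_num [primorial, Finset.prod_filter, Finset.prod_range_succ, Nat.prime_two]
      _ ≤ θ X := theta_mono hX

/-- Induction from n/4 to n replaces partial summation. For p > n/4 one has 1/√p ≤ 2/√n, so these
primes contribute at most 2 θ(n)/√n ≤ 2 log 4 √n; the inductive part gives another 2 log 4 √n
because √(n/4) = √n / 2. -/
lemma sum_log_div_sqrt_le_nat (n : ℕ) :
    ∑ p ∈ (Finset.Icc 1 n).filter Nat.Prime, Real.log p / √p ≤ 4 * Real.log 4 * √n := by
  induction n using Nat.strong_induction_on with
  | _ n ih =>
    rcases Nat.eq_zero_or_pos n with rfl | hn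
    · simp
    have hn' : (0 : ℝ) < n := by exact_mod_cast hn
    have hs : 0 < √(n : ℝ) := Real.sqrt_pos.2 hn'
    have hl4 : 0 ≤ Real.log 4 := Real.log_nonneg (by norm_num)
    have h1 := ih (n / 4) (Nat.div_lt_self hn (by norm_num))
    have h2 : √((n / 4 : ℕ) : ℝ) ≤ √n / 2 := by
      rw [Real.sqrt_le_left (by positivity), div_pow, Real.sq_sqrt hn'.le]
      refine Nat.cast_div_le.trans ?_
      norm_num
    have hsub : (Finset.Icc 1 (n / 4)).filter Nat.Prime ⊆ (Finset.Icc 1 n).filter Nat.Prime :=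
      Finset.filter_subset_filter _ (Finset.Icc_subset_Icc_right (Nat.div_le_self _ _))
    rw [← Finset.sum_sdiff hsub]
    have h3 : ∑ p ∈ (Finset.Icc 1 n).filter Nat.Prime \ (Finset.Icc 1 (n / 4)).filter Nat.Prime,
        Real.log p / √p ≤ 2 / √n * θ n := by
      rw [← sum_log_primesUpTo, primesUpTo, Nat.floor_natCast, Finset.mul_sum]
      refine (Finset.sum_le_sum fun p hp => ?_).trans
        (Finset.sum_le_sum_of_subset_of_nonneg Finset.sdiff_subset fun p _ _ => by positivity)
      simp only [Finset.mem_sdiff, Finset.mem_filter, Finset.mem_Icc] at hp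
      have hp4 : n / 4 < p := by
        by_contra hle
        exact hp.2 ⟨⟨hp.1.1.1, not_lt.1 hle⟩, hp.1.2⟩
      have hp4' : (n : ℝ) ≤ 4 * p := by
        have : n ≤ 4 * p := by omega
        exact_mod_cast this
      have hp0 : (0 : ℝ) < p := by exact_mod_cast hp.1.2.pos
      have hsp : √(n : ℝ) ≤ 2 * √p := by
        rw [Real.sqrt_le_left (by positivity), mul_pow, Real.sq_sqrt hp0.le]
        linarith
      have hsp0 : 0 < √(p : ℝ) := Real.sqrt_pos.2 hp0
      have hlp : 0 ≤ Real.log (p : ℝ) := Real.log_natCast_nonneg p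
      rw [div_mul_eq_mul_div, div_le_div_iff₀ hsp0 hs]
      nlinarith
    have h4 : 2 / √(n : ℝ) * θ n ≤ 2 * Real.log 4 * √n := by
      calc 2 / √(n : ℝ) * θ n ≤ 2 / √(n : ℝ) * (Real.log 4 * n) := by
            gcongr
            exact theta_le_log4_mul_x hn'.le
        _ = 2 * Real.log 4 * √n := by
            nth_rw 2 [← Real.mul_self_sqrt hn'.le]
            field_simp
    nlinarith

lemma sum_log_div_sqrt_le {X : ℝ} (hX : 0 ≤ X) :
    ∑ p ∈ primesUpTo X, Real.log p / √p ≤ 4 * Real.log 4 * √X := by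
  refine (sum_log_div_sqrt_le_nat _).trans ?_
  have hl4 : 0 ≤ Real.log 4 := Real.log_nonneg (by norm_num)
  gcongr
  exact Nat.floor_le hX

end Primes

/-! ### Weighted means and the conclusion. -/

lemma abs_logMean_sub_one_le {S : Finset ℕ} {f : ℕ → ℝ} {A X c : ℝ} (hS : S ⊆ primesUpTo X)
    (hf : ∀ p, 0 < p → |f p - 1| ≤ A / √p) (hA : 0 ≤ A) (hc : 0 < c) (hX : 0 < X)
    (hsum : c * X ≤ ∑ p ∈ S, Real.log p) :
    |logMean S f - 1| ≤ 4 * Real.log 4 * A / c / √X := by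
  have hpos : 0 < ∑ p ∈ S, Real.log (p : ℝ) := (mul_pos hc hX).trans_le hsum
  have hs : 0 < √X := Real.sqrt_pos.2 hX
  have hl4 : 0 ≤ Real.log 4 := Real.log_nonneg (by norm_num)
  have hnum : |∑ p ∈ S, Real.log (p : ℝ) * (f p - 1)| ≤ A * (4 * Real.log 4 * √X) := by
    refine (Finset.abs_sum_le_sum_abs _ _).trans ?_
    calc ∑ p ∈ S, |Real.log (p : ℝ) * (f p - 1)|
        ≤ ∑ p ∈ S, A * (Real.log p / √p) := by
          refine Finset.sum_le_sum fun p hp => ?_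
          have hp0 : 0 < p := by
            have := hS hp
            simp only [primesUpTo, Finset.mem_filter] at this
            exact this.2.pos
          rw [abs_mul, abs_of_nonneg (Real.log_natCast_nonneg p)]
          calc _ ≤ Real.log (p : ℝ) * (A / √p) :=
                mul_le_mul_of_nonneg_left (hf p hp0) (Real.log_natCast_nonneg p)
            _ = _ := by ring
      _ = A * ∑ p ∈ S, Real.log p / √p := (Finset.mul_sum _ _ _).symm
      _ ≤ A * ∑ p ∈ primesUpTo X, Real.log p / √p := by
          gcongr
      _ ≤ _ := by gcongr; exact sum_log_div_sqrt_le hX.le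
  have heq : logMean S f - 1 =
      (∑ p ∈ S, Real.log (p : ℝ) * (f p - 1)) / ∑ p ∈ S, Real.log (p : ℝ) := by
    rw [logMean, eq_div_iff hpos.ne', sub_mul, div_mul_cancel₀ _ hpos.ne', one_mul]
    simp [mul_sub]
  rw [heq, abs_div, abs_of_pos hpos]
  calc _ ≤ A * (4 * Real.log 4 * √X) / (c * X) := by gcongr
    _ = 4 * Real.log 4 * A / c / √X := by
        nth_rw 2 [← Real.mul_self_sqrt hX.le]
        field_simp

/-- C depends only on c and is chosen before E, S and X. This gives the uniformity in E, for all
primes and for good primes alike. -/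
lemma exists_abs_logMean_add_le (c : ℝ) (hc : 0 < c) : ∃ C : ℝ, 0 ≤ C ∧
    ∀ (E : WeierstrassCurve ℚ) (S : Finset ℕ) (X : ℝ), 0 < X → S ⊆ primesUpTo X →
      c * X ≤ ∑ p ∈ S, Real.log p →
      |logMean S (basepointU E) - 1| + |logMean S (basepointLambda E) - 1| ≤ C / √X := by
  have hl4 : 0 ≤ Real.log 4 := Real.log_nonneg (by norm_num)
  refine ⟨4 * Real.log 4 * 1057 / c + 4 * Real.log 4 * 1085507 / c, by positivity,
    fun E S X hX hS hsum => ?_⟩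
  rw [add_div]
  exact add_le_add
    (abs_logMean_sub_one_le hS (fun p hp => abs_basepointU_sub_one_le E hp) (by norm_num) hc hX
      hsum)
    (abs_logMean_sub_one_le hS (fun p hp => abs_basepointLambda_sub_one_le E hp) (by norm_num) hc
      hX hsum)

/-- The primes of good reduction carry a positive proportion of the weight. -/
lemma exists_mul_le_sum_log_goodPrimesUpTo {c : ℝ} (hc : 0 < c)
    (hθ : ∀ X : ℝ, 2 ≤ X → c * X ≤ ∑ p ∈ primesUpTo X, Real.log p)
    (E : WeierstrassCurve ℚ) [E.IsElliptic] :
    ∃ X₀ : ℝ, 3 ≤ X₀ ∧ ∀ X, X₀ ≤ X → c / 2 * X ≤ ∑ p ∈ goodPrimesUpTo E X, Real.log p := by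
  classical
  set B := (finite_not_goodAt E).toFinset
  set b := ∑ p ∈ B, Real.log (p : ℝ)
  -- Beyond 2b/c the weight b of all bad primes is at most cX/2, half of the available lower bound.
  refine ⟨max 3 (2 * b / c), le_max_left _ _, fun X hX => ?_⟩
  have hX3 : 3 ≤ X := (le_max_left _ _).trans hX
  have hXb : 2 * b ≤ X * c := (div_le_iff₀ hc).1 ((le_max_right _ _).trans hX)
  have hle : ∑ p ∈ primesUpTo X, Real.log (p : ℝ) ≤
      ∑ p ∈ goodPrimesUpTo E X ∪ B, Real.log (p : ℝ) := by
    refine Finset.sum_le_sum_of_subset_of_nonneg (fun p hp => ?_)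
      fun p _ _ => Real.log_natCast_nonneg p
    by_cases hg : GoodAt E p
    · exact Finset.mem_union_left _ (Finset.mem_filter.2 ⟨hp, hg⟩)
    · exact Finset.mem_union_right _ (by simpa [B] using ⟨(Finset.mem_filter.1 hp).2, hg⟩)
  have hun := Finset.sum_union_inter (s₁ := goodPrimesUpTo E X) (s₂ := B)
    (f := fun p : ℕ => Real.log (p : ℝ))
  have hinter : 0 ≤ ∑ p ∈ goodPrimesUpTo E X ∩ B, Real.log (p : ℝ) :=
    Finset.sum_nonneg fun p _ => Real.log_natCast_nonneg p
  have := hθ X (by linarith)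
  linarith

/-- Amounts to 0 < log log X ≤ √X; positivity holds because 3 > e. -/
lemma div_sqrt_le_div_log_log {C X : ℝ} (hC : 0 ≤ C) (hX : 3 ≤ X) :
    C / √X ≤ C / Real.log (Real.log X) := by
  have h1 : 1 < Real.log X := by
    rw [Real.lt_log_iff_exp_lt (by linarith)]
    exact Real.exp_one_lt_d9.trans (by linarith)
  have h2 : Real.log X ≤ 2 * √X := by
    have := Real.log_le_sub_one_of_pos (Real.sqrt_pos.2 (by linarith : 0 < X))
    rw [Real.log_sqrt (by linarith)] at this
    linarith
  have h3 : Real.log (Real.log X) ≤ √X := by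
    have h4 := Real.log_le_sub_one_of_pos (by linarith : 0 < Real.log X / 2)
    rw [Real.log_div (by linarith) (by norm_num)] at h4
    have := Real.log_two_lt_d9
    linarith
  have := Real.log_pos h1
  gcongr

lemma tendsto_one_of_abs_add_le {f g : ℝ → ℝ} {C X₀ : ℝ}
    (h : ∀ X, X₀ ≤ X → |f X - 1| + |g X - 1| ≤ C / √X) :
    Tendsto f atTop (𝓝 1) ∧ Tendsto g atTop (𝓝 1) := by
  have hlim : Tendsto (fun X : ℝ => C / √X) atTop (𝓝 0) :=
    tendsto_const_nhds.div_atTop Real.tendsto_sqrt_atTop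
  constructor <;>
  · rw [tendsto_iff_norm_sub_tendsto_zero]
    refine squeeze_zero' (Eventually.of_forall fun _ => norm_nonneg _) ?_ hlim
    filter_upwards [eventually_ge_atTop X₀] with X hX
    have := h X hX
    rw [Real.norm_eq_abs]
    linarith [abs_nonneg (f X - 1), abs_nonneg (g X - 1)]

end RSCO

theorem mainTheorem8 :
    -- means over all primes `p ≤ X`
    (∀ (E : WeierstrassCurve ℚ) [E.IsElliptic],
      Filter.Tendsto (RSCO.uMean E) Filter.atTop (𝓝 1) ∧
      Filter.Tendsto (RSCO.lambdaMean E) Filter.atTop (𝓝 1)) ∧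
    (∃ C : ℝ, ∀ (E : WeierstrassCurve ℚ) [E.IsElliptic] (X : ℝ), 3 ≤ X →
      |RSCO.uMean E X - 1| + |RSCO.lambdaMean E X - 1| ≤ C / Real.log (Real.log X)) ∧
    (∃ C : ℝ, ∀ (E : WeierstrassCurve ℚ) [E.IsElliptic] (X : ℝ), 2 ≤ X →
      |RSCO.uMean E X - 1| + |RSCO.lambdaMean E X - 1| ≤ C / √X) ∧
    -- means over the primes `p ≤ X` of good reduction only
    (∀ (E : WeierstrassCurve ℚ) [E.IsElliptic],
      Filter.Tendsto (RSCO.uMeanGood E) Filter.atTop (𝓝 1) ∧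
      Filter.Tendsto (RSCO.lambdaMeanGood E) Filter.atTop (𝓝 1)) ∧
    (∃ C : ℝ, ∀ (E : WeierstrassCurve ℚ) [E.IsElliptic], ∃ X₀ : ℝ, ∀ X : ℝ, X₀ ≤ X →
      |RSCO.uMeanGood E X - 1| + |RSCO.lambdaMeanGood E X - 1| ≤ C / Real.log (Real.log X)) ∧
    (∃ C : ℝ, ∀ (E : WeierstrassCurve ℚ) [E.IsElliptic], ∃ X₀ : ℝ, ∀ X : ℝ, X₀ ≤ X →
      |RSCO.uMeanGood E X - 1| + |RSCO.lambdaMeanGood E X - 1| ≤ C / √X) := by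

  classical
  obtain ⟨c, hc, hθ⟩ := RSCO.exists_mul_le_theta
  obtain ⟨C, hC, hall⟩ := RSCO.exists_abs_logMean_add_le c hc
  -- Halving c pays for discarding the bad primes and keeps `C'` independent of the curve.
  obtain ⟨C', hC', hgood⟩ := RSCO.exists_abs_logMean_add_le (c / 2) (by positivity)
  have hA : ∀ (E : WeierstrassCurve ℚ) (X : ℝ), 2 ≤ X →
      |RSCO.uMean E X - 1| + |RSCO.lambdaMean E X - 1| ≤ C / √X := fun E X hX =>
    hall E _ X (by linarith) subset_rfl (hθ X hX)
  have hG : ∀ (E : WeierstrassCurve ℚ) [E.IsElliptic], ∃ X₀ : ℝ, 3 ≤ X₀ ∧ ∀ X, X₀ ≤ X →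
      |RSCO.uMeanGood E X - 1| + |RSCO.lambdaMeanGood E X - 1| ≤ C' / √X := by
    intro E _
    obtain ⟨X₀, h3, h⟩ := RSCO.exists_mul_le_sum_log_goodPrimesUpTo hc hθ E
    exact ⟨X₀, h3, fun X hX =>
      hgood E _ X (by linarith) (Finset.filter_subset _ _) (h X hX)⟩
  refine ⟨fun E _ => RSCO.tendsto_one_of_abs_add_le (hA E), ⟨C, fun E _ X hX => ?_⟩,
    ⟨C, fun E _ X hX => hA E X hX⟩, fun E _ => ?_, ⟨C', fun E _ => ?_⟩, ⟨C', fun E _ => ?_⟩⟩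
  · exact (hA E X (by linarith)).trans (RSCO.div_sqrt_le_div_log_log hC hX)
  · obtain ⟨X₀, -, h⟩ := hG E
    exact RSCO.tendsto_one_of_abs_add_le h
  · obtain ⟨X₀, h3, h⟩ := hG E
    exact ⟨X₀, fun X hX => (h X hX).trans (RSCO.div_sqrt_le_div_log_log hC' (h3.trans hX))⟩
  · obtain ⟨X₀, -, h⟩ := hG E
    exact ⟨X₀, h⟩
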